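/- Let $X$ be a compact complex manifold. For $p,q\ge 0$ let $A^{p,q}(X)$ denote the space of smooth complex-valued differential forms of type $(p,q)$ on $X$, and let $d=\partial+\overline\partial$ be the decomposition of the exterior derivative into its components of bidegree $(1,0)$ and $(0,1)$. Consider the Bott–Chern and Aeppli cohomologies $$H^{p,q}_{BC}(X)=\frac{\ker\partial\cap\ker\overline\partial\cap A^{p,q}(X)}{\operatorname{im}\partial\overline\partial\cap A^{p,q}(X)},\qquad H^{p,q}_{A}(X)=\frac{\ker\partial\overline\partial\cap A^{p,q}(X)}{(\operatorname{im}\partial+\operatorname{im}\overline\partial)\cap A^{p,q}(X)},$$ which are finite-dimensional complex vector spaces, and let $b_k=\dim_{\mathbb C}H^k_{dR}(X;\mathbb C)$ be the Betti numbers. For $k\ge 0$ define the integer $$\Delta^k(X)=\sum_{p+q=k}\bigl(\dim_{\mathbb C}H^{p,q}_{BC}(X)+\dim_{\mathbb C}H^{p,q}_{A}(X)\bigr)-2\,b_k .$$ Then, for every $k\in\mathbb N$, $$\Delta^{2k+1}(X)\equiv 0 \pmod 2 .$$ -/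

import Mathlib

open scoped Manifold ContDiff Topology

noncomputable section

namespace NonKahler

/-! ### Linear algebra: the type decomposition of complex-valued real alternating forms -/

section Linear

variable {V W : Type*} [AddCommGroup V] [Module ℂ V] [TopologicalSpace V] [ContinuousConstSMul ℂ V]
  [AddCommGroup W] [Module ℂ W] [TopologicalSpace W] [ContinuousConstSMul ℂ W]

/-- The complex structure `J`, multiplication by `i`, as a real-linear map. -/
def cxJ (V : Type*) [AddCommGroup V] [Module ℂ V] [TopologicalSpace V]
    [ContinuousConstSMul ℂ V] : V →L[ℝ] V :=
  (Complex.I • ContinuousLinearMap.id ℂ V).restrictScalars ℝ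

@[simp] theorem cxJ_apply (v : V) : cxJ V v = Complex.I • v := rfl

/-- The coefficient with which `v` with its entries in `T` multiplied by `J` occurs in the expansion
of the tuple whose `i`-th entry is `2 vᵢ^{1,0} = vᵢ ⊗ 1 - J vᵢ ⊗ i` for `i ∈ S` and
`2 vᵢ^{0,1} = vᵢ ⊗ 1 + J vᵢ ⊗ i` for `i ∉ S`. -/
def typeCoeff {k : ℕ} (S T : Finset (Fin k)) : ℂ :=
  ∏ i ∈ T, if i ∈ S then -Complex.I else Complex.I

/-- Multilinear map underlying `typeProj`. -/
def typeProjMulti {k : ℕ} (p : ℕ) (η : V [⋀^Fin k]→L[ℝ] ℂ) :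
    ContinuousMultilinearMap ℝ (fun _ : Fin k => V) ℂ :=
  ∑ S ∈ Finset.powersetCard p (Finset.univ : Finset (Fin k)), ((1 / 2 : ℂ) ^ k) •
    ∑ T : Finset (Fin k), typeCoeff S T •
      η.toContinuousMultilinearMap.compContinuousLinearMap
        (fun i => if i ∈ T then cxJ V else ContinuousLinearMap.id ℝ V)

theorem typeProjMulti_apply {k : ℕ} (p : ℕ) (η : V [⋀^Fin k]→L[ℝ] ℂ) (v : Fin k → V) :
    typeProjMulti p η v =
      ∑ S ∈ Finset.powersetCard p (Finset.univ : Finset (Fin k)), (1 / 2 : ℂ) ^ k *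
        ∑ T : Finset (Fin k), typeCoeff S T *
          η (fun i => if i ∈ T then Complex.I • v i else v i) := by
  simp only [typeProjMulti, sum_apply, smul_apply,
    smul_eq_mul, ContinuousMultilinearMap.compContinuousLinearMap_apply]
  refine Finset.sum_congr rfl fun S _ => congrArg _ (Finset.sum_congr rfl fun T _ => ?_)
  congr 1
  refine congrArg η (funext fun i => ?_)
  split_ifs <;> rfl

theorem typeProjMulti_eq_zero {k : ℕ} (p : ℕ) (η : V [⋀^Fin k]→L[ℝ] ℂ) (v : Fin k → V)
    (i j : Fin k) (h : v i = v j) (hij : i ≠ j) : typeProjMulti p η v = 0 := by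
  have hv : ∀ a, v (Equiv.swap i j a) = v a := by
    intro a
    rcases eq_or_ne a i with rfl | hai
    · simp [h]
    rcases eq_or_ne a j with rfl | haj
    · simp [h]
    · rw [Equiv.swap_apply_of_ne_of_ne hai haj]
  have key : typeProjMulti p η v = - typeProjMulti p η v := by
    conv_lhs => rw [typeProjMulti_apply]
    rw [typeProjMulti_apply, ← Finset.sum_neg_distrib]
    refine Finset.sum_equiv (Equiv.finsetCongr (Equiv.swap i j)) (fun S => ?_) (fun S _ => ?_)
    · simp [Finset.mem_powersetCard]
    rw [← mul_neg, ← Finset.sum_neg_distrib]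
    congr 1
    refine Fintype.sum_equiv (Equiv.finsetCongr (Equiv.swap i j)) _ _ (fun T => ?_)
    have hc : typeCoeff (Equiv.finsetCongr (Equiv.swap i j) S)
        (Equiv.finsetCongr (Equiv.swap i j) T) = typeCoeff S T := by
      simp [typeCoeff]
    rw [hc, ← mul_neg]
    congr 1
    have := η.toAlternatingMap.map_swap (fun a => if a ∈ T then Complex.I • v a else v a) hij
    simp only [ContinuousAlternatingMap.coe_toAlternatingMap] at this
    rw [← neg_eq_iff_eq_neg, ← this]
    refine congrArg η (funext fun a => ?_)
    have hm : a ∈ Equiv.finsetCongr (Equiv.swap i j) T ↔ Equiv.swap i j a ∈ T := by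
      simp [Finset.mem_map_equiv]
    simp only [Function.comp, hv, hm]
  exact self_eq_neg.mp key

/-- The component of type `(p, k - p)` of a complex-valued alternating `k`-form `η`:
`(π η)(v₁, …, v_k)` is the sum, over all `S ⊆ {1, …, k}` with `p` elements, of the complex
multilinear extension of `η` at the tuple with entries `vᵢ^{1,0}` (`i ∈ S`), `vᵢ^{0,1}` (`i ∉ S`). -/
def typeProj {k : ℕ} (p : ℕ) (η : V [⋀^Fin k]→L[ℝ] ℂ) : V [⋀^Fin k]→L[ℝ] ℂ where
  toContinuousMultilinearMap := typeProjMulti p η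
  map_eq_zero_of_eq' v i j h hij := typeProjMulti_eq_zero p η v i j h hij

theorem typeProj_apply {k : ℕ} (p : ℕ) (η : V [⋀^Fin k]→L[ℝ] ℂ) (v : Fin k → V) :
    typeProj p η v =
      ∑ S ∈ Finset.powersetCard p (Finset.univ : Finset (Fin k)), (1 / 2 : ℂ) ^ k *
        ∑ T : Finset (Fin k), typeCoeff S T *
          η (fun i => if i ∈ T then Complex.I • v i else v i) :=
  typeProjMulti_apply p η v

theorem typeProj_add {k : ℕ} (p : ℕ) (η θ : V [⋀^Fin k]→L[ℝ] ℂ) :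
    typeProj p (η + θ) = typeProj p η + typeProj p θ := by
  ext v
  simp only [typeProj_apply, ContinuousAlternatingMap.add_apply, mul_add, Finset.sum_add_distrib]

theorem typeProj_smul {k : ℕ} (p : ℕ) (c : ℂ) (η : V [⋀^Fin k]→L[ℝ] ℂ) :
    typeProj p (c • η) = c • typeProj p η := by
  ext v
  simp only [typeProj_apply, ContinuousAlternatingMap.smul_apply, smul_eq_mul, Finset.mul_sum]
  refine Finset.sum_congr rfl fun S _ => Finset.sum_congr rfl fun T _ => ?_
  ring

/-- The type projections commute with pullback by complex-linear maps. -/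
theorem typeProj_comp {k : ℕ} (p : ℕ) (η : W [⋀^Fin k]→L[ℝ] ℂ) (L : V →L[ℂ] W) :
    typeProj p (η.compContinuousLinearMap (L.restrictScalars ℝ)) =
      (typeProj p η).compContinuousLinearMap (L.restrictScalars ℝ) := by
  ext v
  simp only [typeProj_apply, ContinuousAlternatingMap.compContinuousLinearMap_apply]
  refine Finset.sum_congr rfl fun S _ => congrArg _ (Finset.sum_congr rfl fun T _ => ?_)
  congr 1
  refine congrArg η (funext fun i => ?_)
  simp only [Function.comp, ContinuousLinearMap.coe_restrictScalars']
  split_ifs <;> simp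

end Linear

section LinearNormed

variable {E : Type*} [NormedAddCommGroup E] [NormedSpace ℂ E]

theorem norm_typeProj_le {k : ℕ} (p : ℕ) (η : E [⋀^Fin k]→L[ℝ] ℂ) :
    ‖typeProj p η‖ ≤ (∑ _S ∈ Finset.powersetCard p (Finset.univ : Finset (Fin k)),
      (1 / 2 : ℝ) ^ k * ∑ _T : Finset (Fin k), 1) * ‖η‖ := by
  refine ContinuousAlternatingMap.opNorm_le_bound _ (by positivity) fun v => ?_
  rw [typeProj_apply, mul_assoc, Finset.sum_mul]
  refine (norm_sum_le _ _).trans (Finset.sum_le_sum fun S _ => ?_)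
  rw [norm_mul, mul_assoc, Finset.sum_mul, norm_pow]
  have h2 : ‖(1 / 2 : ℂ)‖ = 1 / 2 := by norm_num
  rw [h2]
  refine mul_le_mul_of_nonneg_left ?_ (by positivity)
  refine (norm_sum_le _ _).trans (Finset.sum_le_sum fun T _ => ?_)
  have hc : ‖typeCoeff S T‖ = 1 := by
    rw [typeCoeff, norm_prod]
    refine Finset.prod_eq_one fun i _ => ?_
    split_ifs <;> simp
  rw [norm_mul, hc, one_mul, one_mul]
  refine (η.le_opNorm _).trans (le_of_eq ?_)
  congr 1
  refine Finset.prod_congr rfl fun i _ => ?_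
  split_ifs <;> simp [norm_smul]

/-- `typeProj` as a continuous linear map. -/
def typeProjCLM (E : Type*) [NormedAddCommGroup E] [NormedSpace ℂ E] (k p : ℕ) :
    (E [⋀^Fin k]→L[ℝ] ℂ) →L[ℝ] (E [⋀^Fin k]→L[ℝ] ℂ) :=
  LinearMap.mkContinuous
    { toFun := typeProj p
      map_add' := typeProj_add p
      map_smul' := fun c η => by
        have := typeProj_smul p (c : ℂ) η
        ext v
        exact congrArg (fun θ => θ v) this }
    _ (norm_typeProj_le p)

@[simp] theorem typeProjCLM_apply (k p : ℕ) (η : E [⋀^Fin k]→L[ℝ] ℂ) :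
    typeProjCLM E k p η = typeProj p η := rfl

end LinearNormed

/-! ### Smooth complex-valued differential forms on a complex manifold -/

section Forms

variable {E : Type*} [NormedAddCommGroup E] [NormedSpace ℂ E]
  {X : Type*} [TopologicalSpace X] [ChartedSpace E X]

/-- Not necessarily smooth complex-valued `k`-forms on `X`: for every `x`, an alternating real
`k`-linear form on the tangent space at `x` (a complex vector space, seen as a real one). -/
def RoughForm (E : Type*) [NormedAddCommGroup E] [NormedSpace ℂ E]
    (X : Type*) [TopologicalSpace X] [ChartedSpace E X] (k : ℕ) : Type _ :=
  (x : X) → TangentSpace 𝓘(ℂ, E) x [⋀^Fin k]→L[ℝ] ℂ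

instance (k : ℕ) : AddCommGroup (RoughForm E X k) :=
  inferInstanceAs (AddCommGroup ((x : X) → TangentSpace 𝓘(ℂ, E) x [⋀^Fin k]→L[ℝ] ℂ))

instance (k : ℕ) : Module ℂ (RoughForm E X k) :=
  inferInstanceAs (Module ℂ ((x : X) → TangentSpace 𝓘(ℂ, E) x [⋀^Fin k]→L[ℝ] ℂ))

/-- The expression of a form in a chart `e`: its pullback by `e⁻¹` (meaningful on `e.target`). -/
def RoughForm.inChart {k : ℕ} (η : RoughForm E X k) (e : OpenPartialHomeomorph X E) (y : E) :
    E [⋀^Fin k]→L[ℝ] ℂ :=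
  (η (e.symm y)).compContinuousLinearMap
    ((mfderiv 𝓘(ℂ, E) 𝓘(ℂ, E) e.symm y).restrictScalars ℝ)

variable (E X) in
/-- The complex vector space `A^k(X; ℂ)` of smooth complex-valued `k`-forms. -/
def Form (k : ℕ) : Submodule ℂ (RoughForm E X k) where
  carrier := {η | ∀ e ∈ atlas E X, ContDiffOn ℝ ∞ (η.inChart e) e.target}
  add_mem' {_ _} hη hθ e he := (hη e he).add (hθ e he)
  zero_mem' _ _ := contDiffOn_const (c := (0 : E [⋀^Fin k]→L[ℝ] ℂ))
  smul_mem' c _ hη e he := (hη e he).const_smul c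

/-- The exterior derivative of a form: at `x`, it is computed in the preferred chart at `x`. -/
def RoughForm.d {k : ℕ} (η : RoughForm E X k) : RoughForm E X (k + 1) := fun x =>
  (extDeriv (η.inChart (chartAt E x)) (chartAt E x x)).compContinuousLinearMap
    ((mfderiv 𝓘(ℂ, E) 𝓘(ℂ, E) (chartAt E x) x).restrictScalars ℝ)

/-- Pullbacks at equal points agree. -/
theorem RoughForm.comp_congr {k : ℕ} (η : RoughForm E X k) {x x' : X} (h : x = x')
    (L : TangentSpace 𝓘(ℂ, E) (0 : E) →L[ℝ] TangentSpace 𝓘(ℂ, E) x)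
    (L' : TangentSpace 𝓘(ℂ, E) (0 : E) →L[ℝ] TangentSpace 𝓘(ℂ, E) x')
    (hL : ∀ v, (L v : E) = (L' v : E)) :
    (η x).compContinuousLinearMap L = (η x').compContinuousLinearMap L' := by
  subst h
  have : L = L' := ContinuousLinearMap.ext hL
  rw [this]

theorem RoughForm.differentiableAt_chartAt {k : ℕ} {η : RoughForm E X k} (hη : η ∈ Form E X k)
    (x : X) : DifferentiableAt ℝ (η.inChart (chartAt E x)) (chartAt E x x) :=
  ((hη _ (chart_mem_atlas E x)).contDiffAt ((chartAt E x).open_target.mem_nhds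
    (mem_chart_target E x))).differentiableAt (by simp)

variable [IsManifold 𝓘(ℂ, E) ω X]

theorem contDiffAt_transition {e e' : OpenPartialHomeomorph X E} (he : e ∈ atlas E X)
    (he' : e' ∈ atlas E X) {y : E} (hy : y ∈ e.target) (hy' : e.symm y ∈ e'.source) :
    ContDiffAt ℂ ω (e' ∘ e.symm) y := by
  have h1 : ContMDiffAt 𝓘(ℂ, E) 𝓘(ℂ, E) ω e.symm y :=
    contMDiffAt_symm_of_mem_maximalAtlas (IsManifold.subset_maximalAtlas he) hy
  have h2 : ContMDiffAt 𝓘(ℂ, E) 𝓘(ℂ, E) ω e' (e.symm y) :=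
    contMDiffAt_of_mem_maximalAtlas (IsManifold.subset_maximalAtlas he') hy'
  exact (h2.comp y h1).contDiffAt

/-- Chain rule: `D(e' ∘ e⁻¹) = De' ∘ D(e⁻¹)`. -/
theorem fderiv_transition {e e' : OpenPartialHomeomorph X E} (he : e ∈ atlas E X)
    (he' : e' ∈ atlas E X) {y : E} (hy : y ∈ e.target) (hy' : e.symm y ∈ e'.source) (v : E) :
    fderiv ℝ (e' ∘ e.symm) y v =
      mfderiv 𝓘(ℂ, E) 𝓘(ℂ, E) e' (e.symm y) (mfderiv 𝓘(ℂ, E) 𝓘(ℂ, E) e.symm y v) := by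
  have : IsManifold 𝓘(ℂ, E) 1 X := IsManifold.of_le (n := ω) le_top
  have h := mfderiv_comp (I := 𝓘(ℂ, E)) (I' := 𝓘(ℂ, E)) (I'' := 𝓘(ℂ, E)) y
    (mdifferentiableAt_atlas (I := 𝓘(ℂ, E)) he' hy')
    (mdifferentiableAt_atlas_symm (I := 𝓘(ℂ, E)) he hy)
  rw [mfderiv_eq_fderiv] at h
  have hd : DifferentiableAt ℂ (e' ∘ e.symm) y :=
    (contDiffAt_transition he he' hy hy').differentiableAt (by simp)
  rw [hd.fderiv_restrictScalars ℝ]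
  exact congrArg (fun L : E →L[ℂ] E => L v) h

/-- Chain rule: `D(e'⁻¹) ∘ D(e' ∘ e⁻¹) = D(e⁻¹)`. -/
theorem mfderiv_symm_transition {e e' : OpenPartialHomeomorph X E} (he : e ∈ atlas E X)
    (he' : e' ∈ atlas E X) {y : E} (hy : y ∈ e.target) (hy' : e.symm y ∈ e'.source) (v : E) :
    (mfderiv 𝓘(ℂ, E) 𝓘(ℂ, E) e'.symm ((e' ∘ e.symm) y) (fderiv ℝ (e' ∘ e.symm) y v) : E) =
      (mfderiv 𝓘(ℂ, E) 𝓘(ℂ, E) e.symm y v : E) := by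
  have : IsManifold 𝓘(ℂ, E) 1 X := IsManifold.of_le (n := ω) le_top
  have hd : DifferentiableAt ℂ (e' ∘ e.symm) y :=
    (contDiffAt_transition he he' hy hy').differentiableAt (by simp)
  have h := mfderiv_comp (I := 𝓘(ℂ, E)) (I' := 𝓘(ℂ, E)) (I'' := 𝓘(ℂ, E)) y
    (g := e'.symm) (f := e' ∘ e.symm)
    (mdifferentiableAt_atlas_symm (I := 𝓘(ℂ, E)) he' (e'.map_source hy'))
    hd.mdifferentiableAt
  have heq : (e'.symm ∘ (e' ∘ e.symm)) =ᶠ[𝓝 y] e.symm := by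
    have : ∀ᶠ z in 𝓝 y, e.symm z ∈ e'.source :=
      (e.continuousAt_symm hy).preimage_mem_nhds (e'.open_source.mem_nhds hy')
    filter_upwards [this] with z hz
    exact e'.left_inv hz
  have h3 := heq.mfderiv_eq (I := 𝓘(ℂ, E)) (I' := 𝓘(ℂ, E))
  rw [hd.fderiv_restrictScalars ℝ]
  have h4 : (mfderiv 𝓘(ℂ, E) 𝓘(ℂ, E) (e'.symm ∘ (e' ∘ e.symm)) y : E →L[ℂ] E) =
    (mfderiv 𝓘(ℂ, E) 𝓘(ℂ, E) e.symm y : E →L[ℂ] E) := h3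
  rw [mfderiv_eq_fderiv] at h
  have h5 : (mfderiv 𝓘(ℂ, E) 𝓘(ℂ, E) (e'.symm ∘ (e' ∘ e.symm)) y : E →L[ℂ] E) v =
    (mfderiv 𝓘(ℂ, E) 𝓘(ℂ, E) e'.symm ((e' ∘ e.symm) y) : E →L[ℂ] E)
      (fderiv ℂ (e' ∘ e.symm) y v) := congrArg (fun L : E →L[ℂ] E => L v) h
  exact h5.symm.trans (congrArg (fun L : E →L[ℂ] E => L v) h4)

/-- Change of charts. -/
theorem RoughForm.inChart_eq {k : ℕ} (η : RoughForm E X k)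
    {e e' : OpenPartialHomeomorph X E} (he : e ∈ atlas E X) (he' : e' ∈ atlas E X)
    {y : E} (hy : y ∈ e.target) (hy' : e.symm y ∈ e'.source) :
    η.inChart e y = (η.inChart e' ((e' ∘ e.symm) y)).compContinuousLinearMap
      (fderiv ℝ (e' ∘ e.symm) y) :=
  η.comp_congr (e'.left_inv hy').symm
    ((mfderiv 𝓘(ℂ, E) 𝓘(ℂ, E) e.symm y).restrictScalars ℝ)
    (((mfderiv 𝓘(ℂ, E) 𝓘(ℂ, E) e'.symm ((e' ∘ e.symm) y)).restrictScalars ℝ).comp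
      (fderiv ℝ (e' ∘ e.symm) y))
    fun v => (mfderiv_symm_transition he he' hy hy' v).symm

/-- The exterior derivative can be computed in any chart of the atlas. -/
theorem RoughForm.inChart_d {k : ℕ} {η : RoughForm E X k} (hη : η ∈ Form E X k)
    {e : OpenPartialHomeomorph X E} (he : e ∈ atlas E X) {y : E} (hy : y ∈ e.target) :
    η.d.inChart e y = extDeriv (η.inChart e) y := by
  have he' : chartAt E (e.symm y) ∈ atlas E X := chart_mem_atlas E _
  have hy' : e.symm y ∈ (chartAt E (e.symm y)).source := mem_chart_source E _
  generalize hc : chartAt E (e.symm y) = e' at he' hy'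
  have h1 : η.inChart e =ᶠ[𝓝 y] fun z => (η.inChart e' ((e' ∘ e.symm) z)).compContinuousLinearMap
      (fderiv ℝ (e' ∘ e.symm) z) := by
    have : ∀ᶠ z in 𝓝 y, e.symm z ∈ e'.source :=
      (e.continuousAt_symm hy).preimage_mem_nhds (e'.open_source.mem_nhds hy')
    filter_upwards [this, e.open_target.mem_nhds hy] with z hz hz'
    exact η.inChart_eq he he' hz' hz
  have hmem : (e' ∘ e.symm) y ∈ e'.target := e'.map_source hy'
  have hdiff : DifferentiableAt ℝ (η.inChart e') ((e' ∘ e.symm) y) :=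
    ((hη e' he').contDiffAt (e'.open_target.mem_nhds hmem)).differentiableAt (by simp)
  have hτ : ContDiffAt ℝ ω (e' ∘ e.symm) y :=
    (contDiffAt_transition he he' hy hy').restrict_scalars ℝ
  rw [h1.extDeriv_eq, extDeriv_pullback hdiff hτ (by simp)]
  ext v
  have hfun : ∀ w : E, (fderiv ℝ (e' ∘ e.symm) y w) = _ := fderiv_transition he he' hy hy'
  change (extDeriv (η.inChart (chartAt E (e.symm y))) (chartAt E (e.symm y) (e.symm y)))
    (fun i => mfderiv 𝓘(ℂ, E) 𝓘(ℂ, E) (chartAt E (e.symm y)) (e.symm y)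
      (mfderiv 𝓘(ℂ, E) 𝓘(ℂ, E) e.symm y (v i))) = (extDeriv (η.inChart e') (e' (e.symm y)))
      (fun i => fderiv ℝ (e' ∘ e.symm) y (v i))
  rw [hc]
  exact congrArg _ (funext fun i => (hfun (v i)).symm)

theorem RoughForm.d_mem {k : ℕ} {η : RoughForm E X k} (hη : η ∈ Form E X k) :
    η.d ∈ Form E X (k + 1) := by
  intro e he
  have h : ContDiffOn ℝ ∞ (extDeriv (η.inChart e)) e.target := by
    have h1 : ContDiffOn ℝ ∞ (fderiv ℝ (η.inChart e)) e.target :=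
      (hη e he).fderiv_of_isOpen e.open_target (by simp)
    exact (ContinuousAlternatingMap.alternatizeUncurryFinCLM ℝ E ℂ).contDiff.comp_contDiffOn h1
  exact h.congr fun y hy => RoughForm.inChart_d hη he hy

variable (E X)

/-- The exterior derivative `d : A^k → A^{k+1}`. -/
def extD (k : ℕ) : Form E X k →ₗ[ℂ] Form E X (k + 1) where
  toFun η := ⟨η.1.d, RoughForm.d_mem η.2⟩
  map_add' η θ := by
    refine Subtype.ext (funext fun x => ?_)
    have h : extDeriv (RoughForm.inChart (η.1 + θ.1) (chartAt E x)) (chartAt E x x) =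
        extDeriv (η.1.inChart (chartAt E x)) (chartAt E x x) +
          extDeriv (θ.1.inChart (chartAt E x)) (chartAt E x x) :=
      extDeriv_add (RoughForm.differentiableAt_chartAt η.2 x)
        (RoughForm.differentiableAt_chartAt θ.2 x)
    exact congrArg (fun α : TangentSpace 𝓘(ℂ, E) (chartAt E x x) [⋀^Fin (k + 1)]→L[ℝ] ℂ =>
      α.compContinuousLinearMap
        ((mfderiv 𝓘(ℂ, E) 𝓘(ℂ, E) (chartAt E x) x).restrictScalars ℝ)) h
  map_smul' c η := by
    refine Subtype.ext (funext fun x => ?_)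
    have h : extDeriv (RoughForm.inChart (c • η.1) (chartAt E x)) (chartAt E x x) =
        c • extDeriv (η.1.inChart (chartAt E x)) (chartAt E x x) := by
      have : fderiv ℝ (RoughForm.inChart (c • η.1) (chartAt E x)) (chartAt E x x) =
          c • fderiv ℝ (η.1.inChart (chartAt E x)) (chartAt E x x) :=
        fderiv_const_smul (RoughForm.differentiableAt_chartAt η.2 x) c
      rw [extDeriv, this, ContinuousAlternatingMap.alternatizeUncurryFin_smul]
      rfl
    exact congrArg (fun α : TangentSpace 𝓘(ℂ, E) (chartAt E x x) [⋀^Fin (k + 1)]→L[ℝ] ℂ =>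
      α.compContinuousLinearMap
        ((mfderiv 𝓘(ℂ, E) 𝓘(ℂ, E) (chartAt E x) x).restrictScalars ℝ)) h

/-- The projection of `A^k` to the smooth forms of type `(p, k - p)`, taken pointwise. -/
def projType (k p : ℕ) : Form E X k →ₗ[ℂ] Form E X k where
  toFun η := ⟨fun x => typeProj p (η.1 x), fun e he => by
    have h : ContDiffOn ℝ ∞ (fun y => typeProjCLM E k p (η.1.inChart e y)) e.target :=
      (typeProjCLM E k p).contDiff.comp_contDiffOn (η.2 e he)
    refine h.congr fun y _ => ?_
    exact (typeProj_comp p (η.1 (e.symm y)) (mfderiv 𝓘(ℂ, E) 𝓘(ℂ, E) e.symm y)).symm⟩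
  map_add' η θ := by
    refine Subtype.ext (funext fun x => ?_)
    exact typeProj_add p (η.1 x) (θ.1 x)
  map_smul' c η := by
    refine Subtype.ext (funext fun x => ?_)
    exact typeProj_smul p c (η.1 x)

/-- `∂ : A^k → A^{k+1}`: on forms of type `(p, q)` it is the component of `d` of type
`(p + 1, q)`. -/
def del (k : ℕ) : Form E X k →ₗ[ℂ] Form E X (k + 1) :=
  ∑ p ∈ Finset.range (k + 1), projType E X (k + 1) (p + 1) ∘ₗ extD E X k ∘ₗ projType E X k p

/-- `∂̄ : A^k → A^{k+1}`: on forms of type `(p, q)` it is the component of `d` of type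
`(p, q + 1)`. -/
def delbar (k : ℕ) : Form E X k →ₗ[ℂ] Form E X (k + 1) :=
  ∑ p ∈ Finset.range (k + 1), projType E X (k + 1) p ∘ₗ extD E X k ∘ₗ projType E X k p

/-- The space `A^{p,q}` of smooth forms of type `(p, q)`, inside `A^{p+q}`. -/
def FormOfType (p q : ℕ) : Submodule ℂ (Form E X (p + q)) :=
  LinearMap.range (projType E X (p + q) p)

/-- The image of `d` in `A^k`. -/
def imD : (k : ℕ) → Submodule ℂ (Form E X k)
  | 0 => ⊥
  | k + 1 => LinearMap.range (extD E X k)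

/-- The image of `∂` in `A^k`. -/
def imDel : (k : ℕ) → Submodule ℂ (Form E X k)
  | 0 => ⊥
  | k + 1 => LinearMap.range (del E X k)

/-- The image of `∂̄` in `A^k`. -/
def imDelbar : (k : ℕ) → Submodule ℂ (Form E X k)
  | 0 => ⊥
  | k + 1 => LinearMap.range (delbar E X k)

/-- The image of `∂∂̄` in `A^k`. -/
def imDelDelbar : (k : ℕ) → Submodule ℂ (Form E X k)
  | 0 => ⊥
  | 1 => ⊥
  | k + 2 => LinearMap.range (del E X (k + 1) ∘ₗ delbar E X k)

/-- The Bott–Chern cohomology `H_BC^{p,q}`: the part of bidegree `(p, q)` of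
`(ker ∂ ∩ ker ∂̄) / im ∂∂̄`. -/
abbrev BottChern (p q : ℕ) : Type _ :=
  ↥(FormOfType E X p q ⊓ (LinearMap.ker (del E X (p + q)) ⊓ LinearMap.ker (delbar E X (p + q)))) ⧸
    (imDelDelbar E X (p + q)).submoduleOf
      (FormOfType E X p q ⊓ (LinearMap.ker (del E X (p + q)) ⊓ LinearMap.ker (delbar E X (p + q))))

/-- The Aeppli cohomology `H_A^{p,q}`: the part of bidegree `(p, q)` of
`ker ∂∂̄ / (im ∂ + im ∂̄)`. -/
abbrev Aeppli (p q : ℕ) : Type _ :=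
  ↥(FormOfType E X p q ⊓ LinearMap.ker (del E X (p + q + 1) ∘ₗ delbar E X (p + q))) ⧸
    (imDel E X (p + q) ⊔ imDelbar E X (p + q)).submoduleOf
      (FormOfType E X p q ⊓ LinearMap.ker (del E X (p + q + 1) ∘ₗ delbar E X (p + q)))

/-- The complex de Rham cohomology `H_dR^k(X; ℂ) = ker d / im d`. -/
abbrev DeRham (k : ℕ) : Type _ :=
  ↥(LinearMap.ker (extD E X k)) ⧸ (imD E X k).submoduleOf (LinearMap.ker (extD E X k))

/-- `h_BC^{p,q}`. -/
def hBC (p q : ℕ) : ℕ := Module.finrank ℂ (BottChern E X p q)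

/-- `h_A^{p,q}`. -/
def hA (p q : ℕ) : ℕ := Module.finrank ℂ (Aeppli E X p q)

/-- The `k`-th Betti number. -/
def betti (k : ℕ) : ℕ := Module.finrank ℂ (DeRham E X k)

/-- The non-Kählerianity degree
`Δ^k = ∑_{p+q=k} (h_BC^{p,q} + h_A^{p,q}) - 2 b_k`. -/
def nonKahlerDegree (k : ℕ) : ℤ :=
  ∑ pq ∈ Finset.HasAntidiagonal.antidiagonal k, ((hBC E X pq.1 pq.2 : ℤ) + (hA E X pq.1 pq.2 : ℤ)) -
    2 * (betti E X k : ℤ)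

end Forms

end NonKahler

end

/-!
Complex conjugation of forms is a conjugate-linear involution of `A^k` that exchanges the types
`(p, q)` and `(q, p)`, commutes with `d`, and hence exchanges `∂` and `∂̄`. Because `∂∂̄ = -∂̄∂`,
it preserves `ker ∂∂̄` and `im ∂∂̄`, as well as `ker ∂ ∩ ker ∂̄` and `im ∂ + im ∂̄`. So it induces
conjugate-linear isomorphisms `H_BC^{p,q} ≅ H_BC^{q,p}` and `H_A^{p,q} ≅ H_A^{q,p}`, whence
`h_BC^{p,q} = h_BC^{q,p}` (`hBC_comm`) and `h_A^{p,q} = h_A^{q,p}` (`hA_comm`). If `p + q` is odd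
then `p ≠ q`, so the contributions of `(p, q)` and `(q, p)` to `Δ^{p+q}` pair up to an even
number, and `2 b_{p+q}` is even as well.

The identity `∂∂̄ = -∂̄∂` is a consequence of `d² = 0` and of `d = ∂ + ∂̄`, that is, of the fact
that `d` of a form of type `(p, q)` has no components besides those of types `(p + 1, q)` and
`(p, q + 1)`. All facts about types are derived from one identity, `apply_smul_eq_sum_typeProj`:
`η(c v₁, …, c v_k) = ∑_p c^p (conj c)^{k-p} (π_p η)(v₁, …, v_k)` for every complex number `c`,
where `π_p` is the projection to type `(p, k - p)`. As the functions `c^p (conj c)^{k-p}` are linearly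
independent, the identity determines the `π_p η`, and the type of a form can be read off from its
behaviour under complex scaling. For `d` this is carried out in `typeProj_alternatizeUncurryFin`.
-/

noncomputable section

namespace NonKahler

open scoped ComplexConjugate

/-! ### Types of alternating forms and complex scaling -/

section TypeDecomposition

variable {V : Type*} [AddCommGroup V] [Module ℂ V] [TopologicalSpace V] [ContinuousConstSMul ℂ V]

/-- The functions `c ↦ c ^ p * conj c ^ (k - p)`, `0 ≤ p ≤ k`, are linearly independent. This is
what makes the type decomposition of a `k`-form unique. -/
theorem coeff_eq_zero_of_sum_pow_mul_conj_pow {k : ℕ} {a : ℕ → ℂ}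
    (h : ∀ c : ℂ, ∑ p ∈ Finset.range (k + 1), c ^ p * conj c ^ (k - p) * a p = 0)
    {p : ℕ} (hp : p ≤ k) : a p = 0 := by
  have hne : ∀ t : ℝ, (1 - t * Complex.I : ℂ) ≠ 0 := fun t ht => by
    simpa using congrArg Complex.re ht
  -- On `c = 1 + it` the hypothesis, divided by `conj c ^ k`, says that `P = ∑ p, a p X ^ p`
  -- vanishes at `c / conj c`, and these points are pairwise distinct.
  let P : Polynomial ℂ := ∑ p ∈ Finset.range (k + 1), Polynomial.C (a p) * Polynomial.X ^ p
  have hP : P = 0 := by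
    refine Polynomial.eq_zero_of_infinite_isRoot P (Set.infinite_of_injective_forall_mem
      (f := fun t : ℝ => (1 + t * Complex.I) / (1 - t * Complex.I)) (fun s t hst => ?_)
      fun t => ?_)
    · have h1 := (div_eq_div_iff (hne s) (hne t)).1 hst
      have h2 := congrArg Complex.im h1
      simp at h2
      linarith
    · have h1 := h (1 + t * Complex.I)
      have hc : conj (1 + t * Complex.I : ℂ) = 1 - t * Complex.I := by simp [sub_eq_add_neg]
      rw [hc] at h1
      change P.eval _ = 0
      rw [← mul_right_inj' (pow_ne_zero k (hne t)), mul_zero, ← h1, Polynomial.eval_finsetSum,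
        Finset.mul_sum]
      refine Finset.sum_congr rfl fun p hp => ?_
      have hpk : (1 - t * Complex.I : ℂ) ^ k =
          (1 - t * Complex.I) ^ p * (1 - t * Complex.I) ^ (k - p) := by
        rw [← pow_add, Nat.add_sub_cancel' (Finset.mem_range_succ_iff.1 hp)]
      rw [hpk]
      simp only [Polynomial.eval_mul, Polynomial.eval_C, Polynomial.eval_pow, Polynomial.eval_X]
      rw [div_pow]
      field_simp [pow_ne_zero p (hne t)]
  have h1 := congrArg (fun Q => Polynomial.coeff Q p) hP
  simpa [P, Polynomial.finsetSum_coeff, Polynomial.coeff_C_mul, Polynomial.coeff_X_pow,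
    Nat.lt_succ_iff.2 hp] using h1

/-- The coefficient comparison behind `apply_smul_eq_sum_typeProj`: expanding `∏ᵢ (c uᵢ + conj c
wᵢ)`, where `uᵢ` and `wᵢ` are the coefficients of `vᵢ` (`i ∉ T`) or `J vᵢ` (`i ∈ T`) in `vᵢ^{1,0}`
and `vᵢ^{0,1}`, gives the coefficients of `c • vᵢ = re c • vᵢ + im c • J vᵢ`. -/
theorem sum_pow_mul_typeCoeff {k : ℕ} (c : ℂ) (T : Finset (Fin k)) :
    ∑ S : Finset (Fin k), c ^ S.card * conj c ^ (k - S.card) * (1 / 2 : ℂ) ^ k * typeCoeff S T =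
      ∏ i : Fin k, ((if i ∈ T then c.im else c.re : ℝ) : ℂ) := by
  have hsplit : ∀ i : Fin k, ((if i ∈ T then c.im else c.re : ℝ) : ℂ) =
      c * (1 / 2) * (if i ∈ T then -Complex.I else 1) +
        conj c * (1 / 2) * (if i ∈ T then Complex.I else 1) := fun i => by
    split_ifs <;> apply Complex.ext <;> simp <;> ring
  simp_rw [hsplit]
  rw [Finset.prod_add, Finset.powerset_univ]
  refine Finset.sum_congr rfl fun S _ => ?_
  have hcoeff : typeCoeff S T = (∏ i ∈ S, if i ∈ T then -Complex.I else 1) *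
      ∏ i ∈ Finset.univ \ S, if i ∈ T then Complex.I else 1 := by
    have h := Finset.prod_piecewise Finset.univ S (fun i => if i ∈ T then -Complex.I else 1)
      (fun i => if i ∈ T then Complex.I else 1)
    rw [Finset.univ_inter] at h
    rw [← h, typeCoeff, ← Finset.prod_subset (Finset.subset_univ T)]
    · refine Finset.prod_congr rfl fun i hi => ?_
      simp [Finset.piecewise, hi]
    · intro i _ hi
      simp [Finset.piecewise, hi]
  have hk : (1 / 2 : ℂ) ^ k = (1 / 2) ^ S.card * (1 / 2) ^ (k - S.card) := by
    rw [← pow_add, Nat.add_sub_cancel' (by simpa using S.card_le_univ)]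
  have hcard : (Finset.univ \ S).card = k - S.card := by
    rw [← Finset.compl_eq_univ_sdiff, Finset.card_compl, Fintype.card_fin]
  simp only [Finset.prod_mul_distrib, Finset.prod_const, hcard, hcoeff, hk]
  ring

/-- The type components of `η` are its isotypic components under scalar multiplication by complex
numbers: the component of type `(p, k - p)` scales by `c ^ p * conj c ^ (k - p)`. -/
theorem apply_smul_eq_sum_typeProj {k : ℕ} (η : V [⋀^Fin k]→L[ℝ] ℂ) (c : ℂ) (v : Fin k → V) :
    η (fun i => c • v i) =
      ∑ p ∈ Finset.range (k + 1), c ^ p * conj c ^ (k - p) * typeProj p η v := by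
  have hv : (fun i => c • v i) = (fun i => c.im • Complex.I • v i) + fun i => c.re • v i := by
    funext i
    change c • v i = (c.im : ℂ) • Complex.I • v i + (c.re : ℂ) • v i
    rw [smul_smul, ← add_smul, add_comm, Complex.re_add_im]
  have hL : η (fun i => c • v i) = ∑ T : Finset (Fin k),
      (∏ i : Fin k, ((if i ∈ T then c.im else c.re : ℝ) : ℂ)) *
        η (fun i => if i ∈ T then Complex.I • v i else v i) := by
    rw [hv, ContinuousAlternatingMap.map_add_univ]
    refine Finset.sum_congr rfl fun T _ => ?_
    have hT : T.piecewise (fun i => c.im • Complex.I • v i) (fun i => c.re • v i) =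
        fun i => (if i ∈ T then c.im else c.re) • (if i ∈ T then Complex.I • v i else v i) := by
      funext i
      by_cases hi : i ∈ T <;> simp [Finset.piecewise, hi]
    rw [hT, ContinuousAlternatingMap.map_smul_univ, Complex.real_smul, Complex.ofReal_prod]
  have hR : ∑ p ∈ Finset.range (k + 1), c ^ p * conj c ^ (k - p) * typeProj p η v =
      ∑ S : Finset (Fin k), ∑ T : Finset (Fin k),
        c ^ S.card * conj c ^ (k - S.card) * (1 / 2 : ℂ) ^ k * typeCoeff S T *
          η (fun i => if i ∈ T then Complex.I • v i else v i) := by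
    rw [← Finset.powerset_univ, Finset.sum_powerset, Finset.card_fin]
    refine Finset.sum_congr rfl fun p _ => ?_
    rw [typeProj_apply, Finset.mul_sum]
    refine Finset.sum_congr rfl fun S hS => ?_
    rw [(Finset.mem_powersetCard.1 hS).2, ← mul_assoc, Finset.mul_sum, Finset.powerset_univ]
    exact Finset.sum_congr rfl fun T _ => by ring
  rw [hL, hR, Finset.sum_comm]
  refine Finset.sum_congr rfl fun T _ => ?_
  rw [← sum_pow_mul_typeCoeff, Finset.sum_mul]

theorem typeProj_eq_zero_of_lt {k p : ℕ} (hp : k < p) (η : V [⋀^Fin k]→L[ℝ] ℂ) :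
    typeProj p η = 0 := by
  ext v
  rw [typeProj_apply, Finset.powersetCard_eq_empty.2 (by simpa using hp)]
  simp

theorem typeProj_zero {k : ℕ} (p : ℕ) : typeProj p (0 : V [⋀^Fin k]→L[ℝ] ℂ) = 0 := by
  ext v
  simp [typeProj_apply]

theorem sum_typeProj {k : ℕ} (η : V [⋀^Fin k]→L[ℝ] ℂ) :
    ∑ p ∈ Finset.range (k + 1), typeProj p η = η := by
  ext v
  simpa [ContinuousAlternatingMap.sum_apply] using (apply_smul_eq_sum_typeProj η 1 v).symm

/-- Any expansion of `c ↦ η (c • v)` in the functions `c ^ p * conj c ^ (k - p)` has the values of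
the type components of `η` as its coefficients. -/
theorem typeProj_apply_eq_of_forall {k : ℕ} {η : V [⋀^Fin k]→L[ℝ] ℂ} {v : Fin k → V} {a : ℕ → ℂ}
    (h : ∀ c : ℂ, η (fun i => c • v i) =
      ∑ p ∈ Finset.range (k + 1), c ^ p * conj c ^ (k - p) * a p)
    {p : ℕ} (hp : p ≤ k) : typeProj p η v = a p := by
  refine sub_eq_zero.1 (coeff_eq_zero_of_sum_pow_mul_conj_pow (k := k)
    (a := fun p => typeProj p η v - a p) (fun c => ?_) hp)
  simp only [mul_sub, Finset.sum_sub_distrib]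
  rw [← apply_smul_eq_sum_typeProj, ← h, sub_self]

theorem typeProj_apply_smul {k p : ℕ} (hp : p ≤ k) (η : V [⋀^Fin k]→L[ℝ] ℂ) (c : ℂ)
    (v : Fin k → V) :
    typeProj p η (fun i => c • v i) = c ^ p * conj c ^ (k - p) * typeProj p η v := by
  -- Compare coefficients of `d ^ p * conj d ^ (k - p)` in `η (d • c • v) = η ((d * c) • v)`.
  refine typeProj_apply_eq_of_forall (a := fun p => c ^ p * conj c ^ (k - p) * typeProj p η v)
    (fun d => ?_) hp
  simp only [smul_smul]
  rw [apply_smul_eq_sum_typeProj]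
  refine Finset.sum_congr rfl fun p _ => ?_
  rw [map_mul]
  ring

theorem typeProj_eq_zero_of_apply_smul {k p r : ℕ} (hrp : r ≠ p) {η : V [⋀^Fin k]→L[ℝ] ℂ}
    (hp : p ≤ k)
    (h : ∀ (c : ℂ) (v : Fin k → V), η (fun i => c • v i) = c ^ p * conj c ^ (k - p) * η v) :
    typeProj r η = 0 := by
  rcases lt_or_ge k r with hr | hr
  · exact typeProj_eq_zero_of_lt hr η
  ext v
  rw [typeProj_apply_eq_of_forall (a := fun q => if q = p then η v else 0) (fun c => ?_) hr]
  · simp [hrp]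
  · simp [h, Nat.lt_succ_iff.2 hp]

theorem typeProj_typeProj_of_ne {k p r : ℕ} (hrp : r ≠ p) (η : V [⋀^Fin k]→L[ℝ] ℂ) :
    typeProj r (typeProj p η) = 0 := by
  rcases lt_or_ge k p with hp | hp
  · rw [typeProj_eq_zero_of_lt hp]
    exact typeProj_zero r
  · exact typeProj_eq_zero_of_apply_smul hrp hp (typeProj_apply_smul hp η)

theorem typeProj_typeProj_self {k : ℕ} (p : ℕ) (η : V [⋀^Fin k]→L[ℝ] ℂ) :
    typeProj p (typeProj p η) = typeProj p η := by
  rcases lt_or_ge k p with hp | hp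
  · rw [typeProj_eq_zero_of_lt hp, typeProj_eq_zero_of_lt hp]
  · have h := sum_typeProj (typeProj p η)
    rwa [Finset.sum_eq_single_of_mem p (Finset.mem_range_succ_iff.2 hp)
      fun r _ hr => typeProj_typeProj_of_ne hr η] at h

/-- The complex conjugate `v ↦ conj (η v)` of a complex-valued alternating form. -/
def conjAlt {k : ℕ} (η : V [⋀^Fin k]→L[ℝ] ℂ) : V [⋀^Fin k]→L[ℝ] ℂ :=
  (Complex.conjCLE : ℂ →L[ℝ] ℂ).compContinuousAlternatingMap η

omit [ContinuousConstSMul ℂ V] in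
@[simp] theorem conjAlt_apply {k : ℕ} (η : V [⋀^Fin k]→L[ℝ] ℂ) (v : Fin k → V) :
    conjAlt η v = conj (η v) := rfl

theorem typeProj_conjAlt {k p : ℕ} (hp : p ≤ k) (η : V [⋀^Fin k]→L[ℝ] ℂ) :
    typeProj p (conjAlt η) = conjAlt (typeProj (k - p) η) := by
  ext v
  refine typeProj_apply_eq_of_forall (a := fun p => conjAlt (typeProj (k - p) η) v)
    (fun c => ?_) hp
  rw [conjAlt_apply, apply_smul_eq_sum_typeProj, map_sum, ← Finset.sum_range_reflect]
  refine Finset.sum_congr rfl fun p hp => ?_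
  have hp' : p ≤ k := Finset.mem_range_succ_iff.1 hp
  have h1 : k + 1 - 1 - p = k - p := by omega
  have h2 : k - (k - p) = p := by omega
  simp only [h1, h2, map_mul, map_pow, Complex.conj_conj, conjAlt_apply]
  ring

end TypeDecomposition

section Normed

variable {E : Type*} [NormedAddCommGroup E] [NormedSpace ℂ E]

/-- Alternating a one-form with values in the forms of type `(p, k - p)` only produces forms of
types `(p + 1, k - p)` and `(p, k + 1 - p)`. Applied to a derivative, it says that `d` has no
components besides `∂` and `∂̄`. -/
theorem typeProj_alternatizeUncurryFin {k p r : ℕ} (hr : r ≠ p) (hr' : r ≠ p + 1)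
    (A : E →L[ℝ] E [⋀^Fin k]→L[ℝ] ℂ) :
    typeProj r (ContinuousAlternatingMap.alternatizeUncurryFin
      (typeProjCLM E k p ∘L A)) = 0 := by
  set A' := typeProjCLM E k p ∘L A
  rcases lt_or_ge k p with hp | hp
  · have : A' = 0 := by
      ext v : 1
      exact typeProj_eq_zero_of_lt hp (A v)
    rw [this, ← ContinuousAlternatingMap.alternatizeUncurryFinCLM_apply, map_zero]
    exact typeProj_zero r
  rcases lt_or_ge (k + 1) r with hrk | hrk
  · exact typeProj_eq_zero_of_lt hrk _
  ext v
  -- `b` and `b'` are the alternations of `A'` and of `u ↦ A' (J u)`. Since the form argument of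
  -- `A'` scales by `c ^ p * conj c ^ (k - p)` and its vector argument by `c = re c + im c * J`,
  -- the `c`-expansion of the alternation can be read off.
  let b : ℂ := ContinuousAlternatingMap.alternatizeUncurryFin A' v
  let b' : ℂ := ∑ i : Fin (k + 1), (-1) ^ (i : ℕ) • A' (Complex.I • v i) (i.removeNth v)
  rw [typeProj_apply_eq_of_forall (a := fun q => (if q = p then (b + Complex.I * b') / 2 else 0) +
    if q = p + 1 then (b - Complex.I * b') / 2 else 0) (fun c => ?_) hrk]
  · simp [hr, hr']
  · have hterm : ∀ i : Fin (k + 1), A' (c • v i) (i.removeNth fun j => c • v j) =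
        c ^ p * conj c ^ (k - p) * (c.re * A' (v i) (i.removeNth v) +
          c.im * A' (Complex.I • v i) (i.removeNth v)) := fun i => by
      have hc : c • v i = c.re • v i + c.im • Complex.I • v i := by
        change c • v i = (c.re : ℂ) • v i + (c.im : ℂ) • Complex.I • v i
        rw [smul_smul, ← add_smul, Complex.re_add_im]
      have h1 := typeProj_apply_smul hp (A (c • v i)) c (i.removeNth v)
      refine h1.trans (congrArg _ ?_)
      change A' (c • v i) (i.removeNth v) = _
      rw [hc, map_add, map_smul, map_smul]
      simp
    have hsum : ContinuousAlternatingMap.alternatizeUncurryFin A' (fun i => c • v i) =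
        c ^ p * conj c ^ (k - p) * (c.re * b + c.im * b') := by
      simp only [b, b', ContinuousAlternatingMap.alternatizeUncurryFin_apply, hterm,
        Finset.mul_sum, ← Finset.sum_add_distrib]
      refine Finset.sum_congr rfl fun i _ => ?_
      simp only [zsmul_eq_mul, Int.reduceNeg, Int.cast_pow, Int.cast_neg, Int.cast_one]
      ring
    have hre : (c.re : ℂ) = (c + conj c) / 2 := Complex.re_eq_add_conj c
    have him : (c.im : ℂ) = -Complex.I * (c - conj c) / 2 := by
      apply Complex.ext <;> simp
    have hk : k + 1 - p = k - p + 1 := by omega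
    have hk' : k + 1 - (p + 1) = k - p := by omega
    rw [hsum]
    simp only [mul_add, Finset.sum_add_distrib, mul_ite, mul_zero, Finset.sum_ite_eq',
      Finset.mem_range, Nat.lt_succ_iff.2 (Nat.le_succ_of_le hp), Nat.succ_lt_succ_iff,
      Nat.lt_succ_iff.2 hp, if_true, hk, hk']
    rw [hre, him]
    ring

end Normed

/-! ### Conjugation of forms and the operators `d`, `∂`, `∂̄` -/

section Forms

theorem extDeriv_conjAlt {E : Type*} [NormedAddCommGroup E] [NormedSpace ℂ E] {k : ℕ}
    {α : E → E [⋀^Fin k]→L[ℝ] ℂ} {x : E} (hα : DifferentiableAt ℝ α x) :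
    extDeriv (fun y => conjAlt (α y)) x = conjAlt (extDeriv α x) := by
  have h : fderiv ℝ (fun y => conjAlt (α y)) x =
      ContinuousLinearMap.compContinuousAlternatingMapCLM ℝ E ℂ ℂ (Fin k)
        (Complex.conjCLE : ℂ →L[ℝ] ℂ) ∘L fderiv ℝ α x :=
    ((ContinuousLinearMap.compContinuousAlternatingMapCLM ℝ E ℂ ℂ (Fin k)
      (Complex.conjCLE : ℂ →L[ℝ] ℂ)).hasFDerivAt.comp x hα.hasFDerivAt).fderiv
  ext v
  rw [conjAlt_apply, extDeriv, extDeriv, h, ContinuousAlternatingMap.alternatizeUncurryFin_apply,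
    ContinuousAlternatingMap.alternatizeUncurryFin_apply, map_sum]
  refine Finset.sum_congr rfl fun i _ => ?_
  simp only [zsmul_eq_mul, map_mul, map_intCast]
  rfl

variable {E : Type*} [NormedAddCommGroup E] [NormedSpace ℂ E]
  {X : Type*} [TopologicalSpace X] [ChartedSpace E X]

variable (E X) in
/-- Complex conjugation of smooth complex-valued forms, a conjugate-linear involution of `A^k`. -/
def conjForm (k : ℕ) : Form E X k →ₛₗ[starRingEnd ℂ] Form E X k where
  toFun η := ⟨fun x => conjAlt (η.1 x), fun e he =>
    (ContinuousLinearMap.compContinuousAlternatingMapCLM ℝ E ℂ ℂ (Fin k)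
      (Complex.conjCLE : ℂ →L[ℝ] ℂ)).contDiff.comp_contDiffOn (η.2 e he)⟩
  map_add' η θ := Subtype.ext <| funext fun x => ContinuousAlternatingMap.ext fun v =>
    map_add (starRingEnd ℂ) (η.1 x v) (θ.1 x v)
  map_smul' c η := Subtype.ext <| funext fun x => ContinuousAlternatingMap.ext fun v =>
    map_mul (starRingEnd ℂ) c (η.1 x v)

theorem conjForm_conjForm {k : ℕ} (η : Form E X k) : conjForm E X k (conjForm E X k η) = η :=
  Subtype.ext <| funext fun x => ContinuousAlternatingMap.ext fun v => Complex.conj_conj (η.1 x v)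

theorem projType_conjForm {k p : ℕ} (hp : p ≤ k) (η : Form E X k) :
    projType E X k p (conjForm E X k η) = conjForm E X k (projType E X k (k - p) η) :=
  Subtype.ext <| funext fun x => typeProj_conjAlt hp (η.1 x)

theorem projType_projType_of_ne {k p r : ℕ} (h : r ≠ p) (η : Form E X k) :
    projType E X k r (projType E X k p η) = 0 :=
  Subtype.ext <| funext fun x => typeProj_typeProj_of_ne h (η.1 x)

theorem projType_projType_self {k : ℕ} (p : ℕ) (η : Form E X k) :
    projType E X k p (projType E X k p η) = projType E X k p η :=
  Subtype.ext <| funext fun x => typeProj_typeProj_self p (η.1 x)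

theorem sum_projType {k : ℕ} (η : Form E X k) :
    ∑ p ∈ Finset.range (k + 1), projType E X k p η = η := by
  refine Subtype.ext <| funext fun x => ?_
  rw [AddSubmonoidClass.coe_finsetSum]
  refine (Finset.sum_apply x _ _).trans ?_
  exact sum_typeProj (η.1 x)

variable [IsManifold 𝓘(ℂ, E) ω X]

theorem extD_conjForm {k : ℕ} (η : Form E X k) :
    extD E X k (conjForm E X k η) = conjForm E X (k + 1) (extD E X k η) := by
  refine Subtype.ext <| funext fun x => ?_
  have h := extDeriv_conjAlt (RoughForm.differentiableAt_chartAt η.2 x)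
  exact congrArg (fun α : TangentSpace 𝓘(ℂ, E) (chartAt E x x) [⋀^Fin (k + 1)]→L[ℝ] ℂ =>
    α.compContinuousLinearMap
      ((mfderiv 𝓘(ℂ, E) 𝓘(ℂ, E) (chartAt E x) x).restrictScalars ℝ)) h

theorem extD_extD {k : ℕ} (η : Form E X k) : extD E X (k + 1) (extD E X k η) = 0 := by
  refine Subtype.ext <| funext fun x => ?_
  have h1 : η.1.d.inChart (chartAt E x) =ᶠ[𝓝 (chartAt E x x)]
      extDeriv (η.1.inChart (chartAt E x)) := by
    filter_upwards [(chartAt E x).open_target.mem_nhds (mem_chart_target E x)] with y hy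
    exact RoughForm.inChart_d η.2 (chart_mem_atlas E x) hy
  have h2 : ContDiffAt ℝ ∞ (η.1.inChart (chartAt E x)) (chartAt E x x) :=
    (η.2 _ (chart_mem_atlas E x)).contDiffAt
      ((chartAt E x).open_target.mem_nhds (mem_chart_target E x))
  have h3 : extDeriv (η.1.d.inChart (chartAt E x)) (chartAt E x x) = 0 := by
    rw [h1.extDeriv_eq]
    exact extDeriv_extDeriv_apply h2 (by
      rw [minSmoothness_of_isRCLikeNormedField]; exact ENat.LEInfty.out)
  exact congrArg (fun α : TangentSpace 𝓘(ℂ, E) (chartAt E x x) [⋀^Fin (k + 2)]→L[ℝ] ℂ =>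
    α.compContinuousLinearMap
      ((mfderiv 𝓘(ℂ, E) 𝓘(ℂ, E) (chartAt E x) x).restrictScalars ℝ)) h3

/-- The exterior derivative of a form of type `(p, q)` has components of types `(p + 1, q)` and
`(p, q + 1)` only. -/
theorem projType_extD_projType {k p r : ℕ} (hr : r ≠ p) (hr' : r ≠ p + 1) (η : Form E X k) :
    projType E X (k + 1) r (extD E X k (projType E X k p η)) = 0 := by
  refine Subtype.ext <| funext fun x => ?_
  have h1 : RoughForm.inChart (projType E X k p η).1 (chartAt E x) =
      fun y => typeProjCLM E k p (η.1.inChart (chartAt E x) y) := funext fun y =>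
    (typeProj_comp p (η.1 ((chartAt E x).symm y))
      (mfderiv 𝓘(ℂ, E) 𝓘(ℂ, E) (chartAt E x).symm y)).symm
  have h2 : fderiv ℝ (fun y => typeProjCLM E k p (η.1.inChart (chartAt E x) y)) (chartAt E x x) =
      typeProjCLM E k p ∘L fderiv ℝ (η.1.inChart (chartAt E x)) (chartAt E x x) :=
    ((typeProjCLM E k p).hasFDerivAt.comp _
      (RoughForm.differentiableAt_chartAt η.2 x).hasFDerivAt).fderiv
  have h3 : typeProj r (extDeriv (RoughForm.inChart (projType E X k p η).1 (chartAt E x))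
      (chartAt E x x)) = 0 := by
    rw [h1, extDeriv, h2]
    exact typeProj_alternatizeUncurryFin hr hr' _
  refine (typeProj_comp r _ (mfderiv 𝓘(ℂ, E) 𝓘(ℂ, E) (chartAt E x) x)).trans ?_
  exact congrArg (fun α : TangentSpace 𝓘(ℂ, E) (chartAt E x x) [⋀^Fin (k + 1)]→L[ℝ] ℂ =>
    α.compContinuousLinearMap
      ((mfderiv 𝓘(ℂ, E) 𝓘(ℂ, E) (chartAt E x) x).restrictScalars ℝ)) h3

theorem projType_add_projType_succ_extD {k p : ℕ} (hp : p ≤ k) (η : Form E X k) :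
    projType E X (k + 1) p (extD E X k (projType E X k p η)) +
      projType E X (k + 1) (p + 1) (extD E X k (projType E X k p η)) =
        extD E X k (projType E X k p η) := by
  conv_rhs => rw [← sum_projType (extD E X k (projType E X k p η))]
  refine (Finset.sum_eq_add_of_mem p (p + 1) ?_ ?_ (by omega) fun r _ hr =>
    projType_extD_projType hr.1 hr.2 η).symm <;> rw [Finset.mem_range] <;> omega

theorem del_apply {k : ℕ} (η : Form E X k) : del E X k η = ∑ p ∈ Finset.range (k + 1),
    projType E X (k + 1) (p + 1) (extD E X k (projType E X k p η)) := by
  simp [del]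

theorem delbar_apply {k : ℕ} (η : Form E X k) : delbar E X k η = ∑ p ∈ Finset.range (k + 1),
    projType E X (k + 1) p (extD E X k (projType E X k p η)) := by
  simp [delbar]

theorem del_conjForm {k : ℕ} (η : Form E X k) :
    del E X k (conjForm E X k η) = conjForm E X (k + 1) (delbar E X k η) := by
  rw [del_apply, delbar_apply, map_sum, ← Finset.sum_range_reflect]
  refine Finset.sum_congr rfl fun p hp => ?_
  have hp' : p ≤ k := Finset.mem_range_succ_iff.1 hp
  rw [show k + 1 - 1 - p = k - p by omega, projType_conjForm (by omega), extD_conjForm,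
    projType_conjForm (by omega), show k - (k - p) = p by omega,
    show k + 1 - (k - p + 1) = p by omega]

theorem delbar_conjForm {k : ℕ} (η : Form E X k) :
    delbar E X k (conjForm E X k η) = conjForm E X (k + 1) (del E X k η) := by
  rw [← conjForm_conjForm (delbar E X k (conjForm E X k η)), ← del_conjForm, conjForm_conjForm]

theorem projType_delbar {k p : ℕ} (hp : p ≤ k) (η : Form E X k) :
    projType E X (k + 1) p (delbar E X k η) =
      projType E X (k + 1) p (extD E X k (projType E X k p η)) := by
  rw [delbar_apply, map_sum, Finset.sum_eq_single_of_mem p (Finset.mem_range_succ_iff.2 hp)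
    fun r _ hr => projType_projType_of_ne hr.symm _, projType_projType_self]

theorem projType_succ_del {k p : ℕ} (hp : p ≤ k) (η : Form E X k) :
    projType E X (k + 1) (p + 1) (del E X k η) =
      projType E X (k + 1) (p + 1) (extD E X k (projType E X k p η)) := by
  rw [del_apply, map_sum, Finset.sum_eq_single_of_mem p (Finset.mem_range_succ_iff.2 hp)
    fun r _ hr => projType_projType_of_ne (by omega) _, projType_projType_self]

theorem projType_zero_del {k : ℕ} (η : Form E X k) :
    projType E X (k + 1) 0 (del E X k η) = 0 := by
  rw [del_apply, map_sum]
  exact Finset.sum_eq_zero fun r _ => projType_projType_of_ne (by omega) _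

theorem projType_last_delbar {k : ℕ} (η : Form E X k) :
    projType E X (k + 1) (k + 1) (delbar E X k η) = 0 := by
  rw [delbar_apply, map_sum]
  refine Finset.sum_eq_zero fun r hr => projType_projType_of_ne ?_ _
  have := Finset.mem_range.1 hr
  omega

/-- `∂∂̄ + ∂̄∂ = 0`: on forms of type `(p, q)` the left-hand side is the component of type `(p +
1, q + 1)` of `d² = 0`. -/
theorem del_delbar_add_delbar_del {k : ℕ} (η : Form E X k) :
    del E X (k + 1) (delbar E X k η) + delbar E X (k + 1) (del E X k η) = 0 := by
  rw [del_apply (delbar E X k η), delbar_apply (del E X k η), Finset.sum_range_succ,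
    Finset.sum_range_succ' _ (k + 1), projType_last_delbar, projType_zero_del]
  simp only [map_zero, add_zero]
  rw [← Finset.sum_add_distrib]
  refine Finset.sum_eq_zero fun p hp => ?_
  have hp' : p ≤ k := Finset.mem_range_succ_iff.1 hp
  rw [projType_delbar hp', projType_succ_del hp', ← map_add, ← map_add,
    projType_add_projType_succ_extD hp', extD_extD, map_zero]

theorem delbar_del {k : ℕ} (η : Form E X k) :
    delbar E X (k + 1) (del E X k η) = -del E X (k + 1) (delbar E X k η) :=
  eq_neg_of_add_eq_zero_right (del_delbar_add_delbar_del η)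

end Forms

/-! ### Conjugation symmetry of Bott–Chern and Aeppli numbers -/

section Dimensions

/-- A conjugate-linear involution exchanging two pairs `(A, B)` and `(A', B')` of subspaces
identifies the dimensions of the quotients `A / (A ∩ B)` and `A' / (A' ∩ B')`. -/
theorem finrank_quotient_submoduleOf_eq_of_conj {M : Type*} [AddCommGroup M] [Module ℂ M]
    (σ : M →ₛₗ[starRingEnd ℂ] M) (hσ : Function.Involutive σ) {A A' B B' : Submodule ℂ M}
    (hA : ∀ x ∈ A, σ x ∈ A') (hA' : ∀ x ∈ A', σ x ∈ A)
    (hB : ∀ x ∈ B, σ x ∈ B') (hB' : ∀ x ∈ B', σ x ∈ B) :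
    Module.finrank ℂ (A ⧸ B.submoduleOf A) = Module.finrank ℂ (A' ⧸ B'.submoduleOf A') := by
  let f := (B.submoduleOf A).mapQ (B'.submoduleOf A') (σ.restrict hA) fun x hx => hB x hx
  let g := (B'.submoduleOf A').mapQ (B.submoduleOf A) (σ.restrict hA') fun x hx => hB' x hx
  let e : (A ⧸ B.submoduleOf A) ≃+ (A' ⧸ B'.submoduleOf A') :=
    { f.toAddMonoidHom with
      invFun := g
      left_inv := fun x => by
        induction x using Submodule.Quotient.induction_on with
        | H x => exact congrArg Submodule.Quotient.mk (Subtype.ext (hσ x))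
      right_inv := fun x => by
        induction x using Submodule.Quotient.induction_on with
        | H x => exact congrArg Submodule.Quotient.mk (Subtype.ext (hσ x)) }
  exact congrArg Cardinal.toNat (rank_eq_of_equiv_equiv (starRingEnd ℂ) e
    (starRingAut (R := ℂ)).bijective fun c x => map_smulₛₗ f c x)

end Dimensions

section Symmetry

variable {E : Type*} [NormedAddCommGroup E] [NormedSpace ℂ E]
  {X : Type*} [TopologicalSpace X] [ChartedSpace E X]

theorem conjForm_mem_range_projType {k p q : ℕ} (h : p + q = k) {η : Form E X k}
    (hη : η ∈ LinearMap.range (projType E X k p)) :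
    conjForm E X k η ∈ LinearMap.range (projType E X k q) := by
  obtain ⟨θ, rfl⟩ := hη
  refine ⟨conjForm E X k θ, ?_⟩
  rw [projType_conjForm (by omega), show k - q = p by omega]

variable [IsManifold 𝓘(ℂ, E) ω X]

theorem conjForm_mem_ker_del_inf_ker_delbar {k : ℕ} {η : Form E X k}
    (hη : η ∈ LinearMap.ker (del E X k) ⊓ LinearMap.ker (delbar E X k)) :
    conjForm E X k η ∈ LinearMap.ker (del E X k) ⊓ LinearMap.ker (delbar E X k) := by
  obtain ⟨h1, h2⟩ := hη
  rw [SetLike.mem_coe, LinearMap.mem_ker] at h1 h2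
  rw [Submodule.mem_inf, LinearMap.mem_ker, LinearMap.mem_ker, del_conjForm, delbar_conjForm,
    h1, h2, map_zero]
  exact ⟨rfl, rfl⟩

theorem del_delbar_conjForm {k : ℕ} (η : Form E X k) :
    del E X (k + 1) (delbar E X k (conjForm E X k η)) =
      conjForm E X (k + 2) (-del E X (k + 1) (delbar E X k η)) := by
  rw [delbar_conjForm, del_conjForm, delbar_del]

theorem conjForm_mem_ker_del_delbar {k : ℕ} {η : Form E X k}
    (hη : η ∈ LinearMap.ker (del E X (k + 1) ∘ₗ delbar E X k)) :
    conjForm E X k η ∈ LinearMap.ker (del E X (k + 1) ∘ₗ delbar E X k) := by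
  rw [LinearMap.mem_ker, LinearMap.comp_apply] at hη ⊢
  rw [del_delbar_conjForm, hη, neg_zero, map_zero]

theorem conjForm_mem_imDelDelbar {k : ℕ} {η : Form E X k} (hη : η ∈ imDelDelbar E X k) :
    conjForm E X k η ∈ imDelDelbar E X k := by
  match k, η, hη with
  | 0, η, hη => rw [(Submodule.mem_bot ℂ).1 hη, map_zero]; exact zero_mem _
  | 1, η, hη => rw [(Submodule.mem_bot ℂ).1 hη, map_zero]; exact zero_mem _
  | k + 2, _, ⟨θ, rfl⟩ =>
    refine ⟨-conjForm E X k θ, ?_⟩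
    rw [LinearMap.comp_apply, LinearMap.comp_apply, map_neg, map_neg, del_delbar_conjForm,
      map_neg, neg_neg]

theorem conjForm_mem_imDelbar {k : ℕ} {η : Form E X k} (hη : η ∈ imDel E X k) :
    conjForm E X k η ∈ imDelbar E X k := by
  match k, η, hη with
  | 0, η, hη => rw [(Submodule.mem_bot ℂ).1 hη, map_zero]; exact zero_mem _
  | k + 1, _, ⟨θ, rfl⟩ => exact ⟨conjForm E X k θ, delbar_conjForm θ⟩

theorem conjForm_mem_imDel {k : ℕ} {η : Form E X k} (hη : η ∈ imDelbar E X k) :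
    conjForm E X k η ∈ imDel E X k := by
  match k, η, hη with
  | 0, η, hη => rw [(Submodule.mem_bot ℂ).1 hη, map_zero]; exact zero_mem _
  | k + 1, _, ⟨θ, rfl⟩ => exact ⟨conjForm E X k θ, del_conjForm θ⟩

theorem conjForm_mem_imDel_sup_imDelbar {k : ℕ} {η : Form E X k}
    (hη : η ∈ imDel E X k ⊔ imDelbar E X k) :
    conjForm E X k η ∈ imDel E X k ⊔ imDelbar E X k := by
  obtain ⟨α, hα, β, hβ, rfl⟩ := Submodule.mem_sup.1 hη
  rw [map_add, add_comm]
  exact Submodule.add_mem_sup (conjForm_mem_imDel hβ) (conjForm_mem_imDelbar hα)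

variable (E X)

/-- `h_BC^{p,q}` computed inside `A^k` for an arbitrary name `k` of the total degree `p + q`, so
that the bidegrees `(p, q)` and `(q, p)` can be compared in the same space. -/
theorem hBC_eq_finrank {p q k : ℕ} (h : p + q = k) : hBC E X p q = Module.finrank ℂ
    (↥(LinearMap.range (projType E X k p) ⊓
        (LinearMap.ker (del E X k) ⊓ LinearMap.ker (delbar E X k))) ⧸
      (imDelDelbar E X k).submoduleOf (LinearMap.range (projType E X k p) ⊓
        (LinearMap.ker (del E X k) ⊓ LinearMap.ker (delbar E X k)))) := by
  subst h
  rfl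

/-- `h_A^{p,q}` computed inside `A^k` for an arbitrary name `k` of the total degree `p + q`. -/
theorem hA_eq_finrank {p q k : ℕ} (h : p + q = k) : hA E X p q = Module.finrank ℂ
    (↥(LinearMap.range (projType E X k p) ⊓
        LinearMap.ker (del E X (k + 1) ∘ₗ delbar E X k)) ⧸
      (imDel E X k ⊔ imDelbar E X k).submoduleOf (LinearMap.range (projType E X k p) ⊓
        LinearMap.ker (del E X (k + 1) ∘ₗ delbar E X k))) := by
  subst h
  rfl

/-- Conjugation induces a conjugate-linear isomorphism `H_BC^{p,q} ≅ H_BC^{q,p}`. -/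
theorem hBC_comm (p q : ℕ) : hBC E X p q = hBC E X q p := by
  rw [hBC_eq_finrank E X rfl, hBC_eq_finrank E X (add_comm q p)]
  exact finrank_quotient_submoduleOf_eq_of_conj (conjForm E X (p + q)) conjForm_conjForm
    (fun _ h => ⟨conjForm_mem_range_projType rfl h.1, conjForm_mem_ker_del_inf_ker_delbar h.2⟩)
    (fun _ h => ⟨conjForm_mem_range_projType (add_comm q p) h.1,
      conjForm_mem_ker_del_inf_ker_delbar h.2⟩)
    (fun _ => conjForm_mem_imDelDelbar) (fun _ => conjForm_mem_imDelDelbar)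

/-- Conjugation induces a conjugate-linear isomorphism `H_A^{p,q} ≅ H_A^{q,p}`. -/
theorem hA_comm (p q : ℕ) : hA E X p q = hA E X q p := by
  rw [hA_eq_finrank E X rfl, hA_eq_finrank E X (add_comm q p)]
  exact finrank_quotient_submoduleOf_eq_of_conj (conjForm E X (p + q)) conjForm_conjForm
    (fun _ h => ⟨conjForm_mem_range_projType rfl h.1, conjForm_mem_ker_del_delbar h.2⟩)
    (fun _ h => ⟨conjForm_mem_range_projType (add_comm q p) h.1, conjForm_mem_ker_del_delbar h.2⟩)
    (fun _ => conjForm_mem_imDel_sup_imDelbar) (fun _ => conjForm_mem_imDel_sup_imDelbar)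

end Symmetry

/-- In odd total degree no bidegree `(p, p)` occurs, so the terms of a symmetric sum cancel in
pairs modulo `2`. -/
theorem even_sum_antidiagonal_of_symm {f : ℕ → ℕ → ℤ} (hf : ∀ p q, f p q = f q p) (k : ℕ) :
    Even (∑ pq ∈ Finset.HasAntidiagonal.antidiagonal (2 * k + 1), f pq.1 pq.2) := by
  rw [← ZMod.intCast_eq_zero_iff_even, Int.cast_sum]
  refine Finset.sum_involution (fun pq _ => pq.swap) (fun pq _ => ?_) (fun pq hpq _ h => ?_)
    (fun pq hpq => Finset.HasAntidiagonal.swap_mem_antidiagonal.2 hpq) (fun pq _ => pq.swap_swap)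
  · rw [Prod.fst_swap, Prod.snd_swap, hf pq.2 pq.1]
    exact CharTwo.add_self_eq_zero _
  · have h1 := Finset.HasAntidiagonal.mem_antidiagonal.1 hpq
    have h2 : pq.2 = pq.1 := congrArg Prod.fst h
    omega

end NonKahler

end

theorem mainTheorem6 {E : Type*} [NormedAddCommGroup E] [NormedSpace ℂ E] [FiniteDimensional ℂ E]
    {X : Type*} [TopologicalSpace X] [ChartedSpace E X] [IsManifold 𝓘(ℂ, E) ω X]
    [CompactSpace X] [T2Space X] (k : ℕ) :
    NonKahler.nonKahlerDegree E X (2 * k + 1) ≡ 0 [ZMOD 2] := by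
  have h := NonKahler.even_sum_antidiagonal_of_symm
    (f := fun p q => (NonKahler.hBC E X p q : ℤ) + NonKahler.hA E X p q)
    (fun p q => by simp only [NonKahler.hBC_comm E X p q, NonKahler.hA_comm E X p q]) k
  exact Int.even_iff.1 (h.sub (even_two_mul (NonKahler.betti E X (2 * k + 1) : ℤ)))
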